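/- Let $G$ be a finite connected simple graph with vertex set $V$. A random walk labeling of $G$ is a labeling of $V$ by $1,\dots,|V|$ that is obtainable by the following process. Choose a vertex $v$ and label it $1$. As long as there are unlabeled vertices, move from the current vertex to an adjacent vertex, and if the new vertex is not labeled yet, give it the smallest label not yet used. Let $\mathcal{L}(G)$ be the number of random walk labelings of $G$. For $m\ge 3$ and $n\ge 1$ let $S_{m,n}$ be the graph obtained from the path graph with $n+1$ vertices by replacing each of its $n$ edges with an edge of a (separate) cycle graph $C_m$ on $m$ vertices; $S_{3,n}$ is called the triangular snake. Then, for every integer $n\ge 1$, $$\mathcal{L}(S_{3,n}) = 2^{n}(n-1)!\left(\sum_{k=0}^{n-1}\frac{\binom{2n-1}{2k}}{\binom{n-1}{k}}+n\sum_{k=0}^{n}\frac{\binom{2n}{2k}}{\binom{n}{k}}\right).$$ -/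

import Mathlib

/-- The states that the random walk labeling process on the graph `G` can reach.
`RandomWalkState G v i ℓ` says that the walk can stand at the vertex `v` when `i` is the last label
used and `ℓ` is the partial labeling so far; labels start at `1`, and `ℓ x = 0` means that
`x` has not been labeled yet. The walk moves on only as long as some vertex is not labeled. -/
inductive RandomWalkState {V : Type*} [DecidableEq V] (G : SimpleGraph V) :
    V → ℕ → (V → ℕ) → Prop
  /-- Pick a starting vertex and label it with `1`. -/
  | start (v : V) : RandomWalkState G v 1 (Function.update (fun _ => 0) v 1)
  /-- Move to an adjacent vertex which is not labeled, and give it the next label. -/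
  | visitNew {v w : V} {i : ℕ} {ℓ : V → ℕ} (h : RandomWalkState G v i ℓ)
      (hvw : G.Adj v w) (hw : ℓ w = 0) :
      RandomWalkState G w (i + 1) (Function.update ℓ w (i + 1))
  /-- Move to an adjacent vertex which is already labeled. -/
  | visitOld {v w : V} {i : ℕ} {ℓ : V → ℕ} (h : RandomWalkState G v i ℓ)
      (hvw : G.Adj v w) (hw : ℓ w ≠ 0) (hleft : ∃ x, ℓ x = 0) :
      RandomWalkState G w i ℓ

/-- A random walk labeling of `G`: a labeling of all vertices which the process can produce. -/
def IsRandomWalkLabeling {V : Type*} [DecidableEq V] (G : SimpleGraph V) (ℓ : V → ℕ) : Prop :=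
  (∃ v i, RandomWalkState G v i ℓ) ∧ ∀ x, ℓ x ≠ 0

/-- `𝓛(G)`, the number of random walk labelings of `G`. -/
noncomputable def numRandomWalkLabelings {V : Type*} [DecidableEq V] (G : SimpleGraph V) : ℕ :=
  {ℓ : V → ℕ | IsRandomWalkLabeling G ℓ}.ncard

/-- The snake graph `S_{m,n}` (for `m ≥ 3`): in the path graph with `n + 1` vertices, each edge is
replaced with an edge of a cycle graph `C_m`.

The vertices are numbered `0, …, n (m - 1)` along the snake. The path vertices are the multiples
`i (m - 1)`, `0 ≤ i ≤ n`, and the `i`-th cycle (`0 ≤ i < n`) consists of the `m` vertices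
`i (m - 1) + a`, `0 ≤ a ≤ m - 1`; its vertices for `a = 0` and `a = m - 1` are adjacent in `C_m`
and are the ends of the `i`-th edge of the path. -/
def snakeGraph (m n : ℕ) : SimpleGraph (Fin (n * (m - 1) + 1)) where
  Adj u v := ∃ (i : Fin n) (a b : Fin m), (SimpleGraph.cycleGraph m).Adj a b ∧
    (u : ℕ) = i * (m - 1) + a ∧ (v : ℕ) = i * (m - 1) + b
  symm := ⟨fun _ _ ⟨i, a, b, h, hu, hv⟩ => ⟨i, b, a, h.symm, hv, hu⟩⟩
  loopless := ⟨fun u ⟨_, a, b, h, hu, hv⟩ => h.ne (Fin.ext (by omega))⟩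

/-!
A random walk can wander freely through the vertices it has labeled, because they form a connected
set. Hence its labelings are exactly the orders in which the vertices can be added one at a time,
each new vertex being adjacent to an earlier one (`mem_growthLabelings_iff`). Let `N S` be the
number of ways to complete such an order once the set `S` is labeled. Then `N S` is the sum of
`N (insert w S)` over the boundary vertices `w` of `S`, and any function that satisfies this
recurrence and is `1` on the full set gives the number of labelings as the sum of its values on
singletons (`numRandomWalkLabelings_eq_sum`).

In the triangular snake, a connected set that contains a path vertex is a run of path vertices
together with some apexes of triangles at that run (`IsSnakeSpan`). Suppose that `a` triangles lie
to the left of the run and `c` to the right, and that `T` vertices are missing. Then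
`N S = T! / ((2 * a - 1)‼ * (2 * c - 1)‼)`. Indeed, a missing apex inside the run changes neither
double factorial; on the left, where `2 * a` or `2 * a - 1` vertices are missing, the boundary is
an apex and a path vertex or a path vertex alone, and since
`1 / (2 * a - 3)‼ = (2 * a - 1) / (2 * a - 1)‼` both cases contribute the number of missing vertices
on the left as a factor (`IsSnakeSpan.sum_left`). The right side is alike, so the
factors add up to `T` (`IsSnakeSpan.spanWeight_eq_sum`).

The singletons of path vertices give the sum with `2 * n`. The second label after an apex goes to
one of the two path vertices of its triangle, and by reflection the two choices contribute equally
in total, which gives the sum with `2 * n - 1`.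
-/

open Finset

/-! ### Positions of the walk -/

section Walk

variable {V : Type*} [DecidableEq V] {G : SimpleGraph V}

lemma RandomWalkState.label_ne_zero {v : V} {i : ℕ} {ℓ : V → ℕ}
    (h : RandomWalkState G v i ℓ) : ℓ v ≠ 0 := by
  cases h <;> simp_all

lemma RandomWalkState.one_le {v : V} {i : ℕ} {ℓ : V → ℕ}
    (h : RandomWalkState G v i ℓ) : 1 ≤ i := by
  induction h <;> omega

/-- The labeled vertices are connected to the current position through labeled vertices. -/
lemma RandomWalkState.reflTransGen {v : V} {i : ℕ} {ℓ : V → ℕ}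
    (h : RandomWalkState G v i ℓ) : ∀ u, ℓ u ≠ 0 →
      Relation.ReflTransGen (fun a b => G.Adj a b ∧ ℓ b ≠ 0) v u := by
  induction h with
  | start v =>
    intro u hu
    by_cases h : u = v
    · subst h; exact .refl
    · simp [h] at hu
  | @visitNew v w i ℓ h hvw hw ih =>
    intro u hu
    by_cases huw : u = w
    · subst huw; exact .refl
    · have mono : ∀ x, ℓ x ≠ 0 → Function.update ℓ w (i + 1) x ≠ 0 := by
        intro x hx
        by_cases hxw : x = w <;> simp [hxw]
        exact hx
      refine .head ⟨hvw.symm, mono _ h.label_ne_zero⟩ ?_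
      exact Relation.ReflTransGen.mono (fun a b hab => ⟨hab.1, mono _ hab.2⟩)
        _ _ (ih u (by simpa [huw] using hu))
  | visitOld h hvw hw hleft ih =>
    intro u hu
    exact .head ⟨hvw.symm, h.label_ne_zero⟩ (ih u hu)

/-- As long as a vertex is unlabeled, the walk can move to any labeled vertex. -/
lemma RandomWalkState.move {v u : V} {i : ℕ} {ℓ : V → ℕ}
    (h : RandomWalkState G v i ℓ) (hleft : ∃ x, ℓ x = 0) (hu : ℓ u ≠ 0) :
    RandomWalkState G u i ℓ := by
  have hr := h.reflTransGen u hu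
  clear hu
  induction hr with
  | refl => exact h
  | tail _ hbc ih => exact ih.visitOld hbc.1 hbc.2 hleft

end Walk

/-! ### Counting random walk labelings by a weight on vertex sets -/

section General

variable {V : Type*} [Fintype V] [DecidableEq V]

/-- The vertices outside `S` with a neighbour in `S`. -/
def vertexBoundary (G : SimpleGraph V) [DecidableRel G.Adj] (S : Finset V) : Finset V :=
  {w | w ∉ S ∧ ∃ u ∈ S, G.Adj u w}

/-- The set of vertices that a partial labeling has labeled. -/
def labeledSet (ℓ : V → ℕ) : Finset V := {x | ℓ x ≠ 0}

omit [DecidableEq V] in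
@[simp] lemma mem_labeledSet {ℓ : V → ℕ} {x : V} : x ∈ labeledSet ℓ ↔ ℓ x ≠ 0 := by
  simp [labeledSet]

lemma mem_vertexBoundary {G : SimpleGraph V} [DecidableRel G.Adj] {S : Finset V} {w : V} :
    w ∈ vertexBoundary G S ↔ w ∉ S ∧ ∃ u ∈ S, G.Adj u w := by
  simp [vertexBoundary]

lemma labeledSet_update (ℓ : V → ℕ) (w : V) {i : ℕ} (hi : i ≠ 0) :
    labeledSet (Function.update ℓ w i) = insert w (labeledSet ℓ) := by
  ext x
  by_cases h : x = w
  · subst h; simp [hi]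
  · simp [h]

lemma labeledSet_start (v : V) :
    labeledSet (Function.update (fun _ => 0) v 1) = {v} := by
  rw [labeledSet_update _ _ one_ne_zero]
  ext x; simp

/-- The partial labelings with `k + 1` labels that arise by labeling one vertex and then
repeatedly labeling a vertex of the boundary of the labeled set. -/
def growthLabelings (G : SimpleGraph V) [DecidableRel G.Adj] : ℕ → Finset (V → ℕ)
  | 0 => univ.image fun v => Function.update (fun _ => 0) v 1
  | k + 1 => (growthLabelings G k).biUnion fun ℓ =>
      (vertexBoundary G (labeledSet ℓ)).image fun w => Function.update ℓ w (k + 2)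

variable {G : SimpleGraph V}

lemma mem_growthLabelings_succ [DecidableRel G.Adj] {k : ℕ} {ℓ' : V → ℕ} :
    ℓ' ∈ growthLabelings G (k + 1) ↔ ∃ ℓ ∈ growthLabelings G k,
      ∃ w ∈ vertexBoundary G (labeledSet ℓ), Function.update ℓ w (k + 2) = ℓ' := by
  simp [growthLabelings]

lemma growthLabelings_le [DecidableRel G.Adj] {k : ℕ} :
    ∀ {ℓ : V → ℕ}, ℓ ∈ growthLabelings G k → ∀ x, ℓ x ≤ k + 1 := by
  induction k with
  | zero =>
    intro ℓ h x
    simp only [growthLabelings, mem_image, mem_univ, true_and] at h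
    obtain ⟨v, rfl⟩ := h
    by_cases hx : x = v <;> simp [hx]
  | succ k ih =>
    intro ℓ h x
    obtain ⟨ℓ', h', w, -, rfl⟩ := mem_growthLabelings_succ.1 h
    have := ih h' x
    by_cases hx : x = w
    · simp [hx]
    · simp [hx]; omega

lemma card_labeledSet_of_mem_growthLabelings [DecidableRel G.Adj] {k : ℕ} :
    ∀ {ℓ : V → ℕ}, ℓ ∈ growthLabelings G k → (labeledSet ℓ).card = k + 1 := by
  induction k with
  | zero =>
    intro ℓ h
    simp only [growthLabelings, mem_image, mem_univ, true_and] at h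
    obtain ⟨v, rfl⟩ := h
    simp [labeledSet_start]
  | succ k ih =>
    intro ℓ h
    obtain ⟨ℓ', h', w, hw, rfl⟩ := mem_growthLabelings_succ.1 h
    rw [labeledSet_update _ _ (by omega), card_insert_of_notMem (mem_vertexBoundary.1 hw).1, ih h']

lemma mem_growthLabelings_iff [DecidableRel G.Adj] {k : ℕ} :
    ∀ {ℓ : V → ℕ}, ℓ ∈ growthLabelings G k ↔ ∃ v, RandomWalkState G v (k + 1) ℓ := by
  have hfwd : ∀ {v i} {ℓ : V → ℕ}, RandomWalkState G v i ℓ → ℓ ∈ growthLabelings G (i - 1) := by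
    intro v i ℓ h
    induction h with
    | start v => exact mem_image_of_mem _ (mem_univ v)
    | @visitNew v w i ℓ h hvw hw ih =>
      obtain ⟨j, rfl⟩ : ∃ j, i = j + 1 := ⟨i - 1, by have := h.one_le; omega⟩
      exact mem_growthLabelings_succ.2 ⟨ℓ, ih, w, mem_vertexBoundary.2
        ⟨by simpa using hw, v, by simpa using h.label_ne_zero, hvw⟩, rfl⟩
    | visitOld _ _ _ _ ih => exact ih
  refine fun {ℓ} => ⟨?_, fun ⟨v, h⟩ => hfwd h⟩
  induction k generalizing ℓ with
  | zero =>
    intro h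
    simp only [growthLabelings, mem_image, mem_univ, true_and] at h
    obtain ⟨v, rfl⟩ := h
    exact ⟨v, .start v⟩
  | succ k ih =>
    intro h
    obtain ⟨ℓ', h', w, hw, rfl⟩ := mem_growthLabelings_succ.1 h
    obtain ⟨v, hv⟩ := ih h'
    obtain ⟨hw0, u, hu, huw⟩ := mem_vertexBoundary.1 hw
    have hw0 : ℓ' w = 0 := by simpa using hw0
    exact ⟨w, (hv.move ⟨w, hw0⟩ (by simpa using hu)).visitNew huw hw0⟩

lemma numRandomWalkLabelings_eq_card [DecidableRel G.Adj] [Nonempty V] :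
    numRandomWalkLabelings G = (growthLabelings G (Fintype.card V - 1)).card := by
  have hpos : 0 < Fintype.card V := Fintype.card_pos
  rw [numRandomWalkLabelings, ← Set.ncard_coe_finset]
  congr 1
  ext ℓ
  have hfull : (∀ x, ℓ x ≠ 0) ↔ (labeledSet ℓ).card = Fintype.card V := by
    rw [card_eq_iff_eq_univ, eq_univ_iff_forall]; simp
  constructor
  · rintro ⟨⟨v, i, h⟩, hall⟩
    obtain ⟨j, rfl⟩ : ∃ j, i = j + 1 := ⟨i - 1, by have := h.one_le; omega⟩
    have hmem := mem_growthLabelings_iff.2 ⟨v, h⟩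
    have := card_labeledSet_of_mem_growthLabelings hmem
    rw [hfull.1 hall] at this
    simpa [this] using hmem
  · intro h
    have hmem : ℓ ∈ growthLabelings G (Fintype.card V - 1) := by simpa using h
    obtain ⟨v, hv⟩ := mem_growthLabelings_iff.1 hmem
    refine ⟨⟨v, _, hv⟩, hfull.2 ?_⟩
    rw [card_labeledSet_of_mem_growthLabelings hmem]; omega

/-- A sum over the labelings with one more label is a sum over the labelings and the boundary
vertices that receive the new label: the new labeling determines both. -/
lemma sum_growthLabelings_succ [DecidableRel G.Adj] (k : ℕ) (N : Finset V → ℚ) :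
    ∑ ℓ ∈ growthLabelings G (k + 1), N (labeledSet ℓ) =
      ∑ ℓ ∈ growthLabelings G k, ∑ w ∈ vertexBoundary G (labeledSet ℓ),
        N (insert w (labeledSet ℓ)) := by
  have key : ∀ ℓ ∈ growthLabelings G k, ∀ ℓ' ∈ growthLabelings G k, ∀ w w' : V,
      ℓ w = 0 → ℓ' w' = 0 → Function.update ℓ w (k + 2) = Function.update ℓ' w' (k + 2) →
      w = w' ∧ ℓ = ℓ' := by
    intro ℓ _ ℓ' h' w w' hw hw' heq
    have hww : w = w' := by
      by_contra hne
      have h1 := congrFun heq w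
      have h2 := growthLabelings_le h' w
      simp [hne] at h1
      omega
    subst hww
    refine ⟨rfl, funext fun x => ?_⟩
    by_cases hx : x = w
    · rw [hx, hw, hw']
    · simpa [hx] using congrFun heq x
  have hzero : ∀ {ℓ : V → ℕ} {w : V}, w ∈ vertexBoundary G (labeledSet ℓ) → ℓ w = 0 :=
    fun hw => by simpa using (mem_vertexBoundary.1 hw).1
  rw [growthLabelings, sum_biUnion]
  · refine sum_congr rfl fun ℓ hℓ => ?_
    rw [sum_image]
    · exact sum_congr rfl fun w _ => by rw [labeledSet_update _ _ (by omega)]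
    · intro w hw w' hw' heq
      exact (key ℓ hℓ ℓ hℓ w w' (hzero hw) (hzero hw') heq).1
  · intro ℓ hℓ ℓ' hℓ' hne
    refine disjoint_left.2 fun f hf hf' => hne ?_
    obtain ⟨w, hw, rfl⟩ := mem_image.1 hf
    obtain ⟨w', hw', heq⟩ := mem_image.1 hf'
    exact (key ℓ hℓ ℓ' hℓ' w w' (hzero hw) (hzero hw') heq.symm).2

/-- If a weight on a family of vertex sets that is closed under adding boundary vertices is the
sum of the weights of the one-vertex extensions, and the full set has weight `1`, then the weight
of a set counts the ways to complete it to a labeling; summing over the first vertex gives the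
number of random walk labelings. -/
theorem numRandomWalkLabelings_eq_sum [DecidableRel G.Adj] [Nonempty V]
    (Q : Finset V → Prop) (N : Finset V → ℚ) (hQ₁ : ∀ v, Q {v})
    (hQ : ∀ S, Q S → ∀ w ∈ vertexBoundary G S, Q (insert w S))
    (hN : ∀ S, Q S → S ≠ univ → N S = ∑ w ∈ vertexBoundary G S, N (insert w S))
    (huniv : N univ = 1) :
    (numRandomWalkLabelings G : ℚ) = ∑ v, N {v} := by
  have hpos : 0 < Fintype.card V := Fintype.card_pos
  have hQmem : ∀ k, ∀ ℓ ∈ growthLabelings G k, Q (labeledSet ℓ) := by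
    intro k
    induction k with
    | zero =>
      intro ℓ h
      simp only [growthLabelings, mem_image, mem_univ, true_and] at h
      obtain ⟨v, rfl⟩ := h
      rw [labeledSet_start]; exact hQ₁ v
    | succ k ih =>
      intro ℓ h
      obtain ⟨ℓ', h', w, hw, rfl⟩ := mem_growthLabelings_succ.1 h
      rw [labeledSet_update _ _ (by omega)]
      exact hQ _ (ih _ h') _ hw
  have hsum : ∀ k < Fintype.card V,
      ∑ ℓ ∈ growthLabelings G k, N (labeledSet ℓ) = ∑ v, N {v} := by
    intro k
    induction k with
    | zero =>
      intro _
      rw [growthLabelings, sum_image]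
      · simp only [labeledSet_start]
      · intro v _ v' _ heq
        simpa [labeledSet_start] using congrArg labeledSet heq
    | succ k ih =>
      intro hk
      rw [sum_growthLabelings_succ, ← ih (by omega)]
      refine sum_congr rfl fun ℓ hℓ => (hN _ (hQmem _ _ hℓ) fun h => ?_).symm
      have := card_labeledSet_of_mem_growthLabelings hℓ
      rw [h, card_univ] at this
      omega
  rw [numRandomWalkLabelings_eq_card, ← hsum _ (Nat.sub_one_lt_of_lt hpos), card_eq_sum_ones]
  push_cast
  refine sum_congr rfl fun ℓ hℓ => ?_
  have hc := card_labeledSet_of_mem_growthLabelings hℓ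
  rw [(card_eq_iff_eq_univ _).1 (by omega : (labeledSet ℓ).card = Fintype.card V), huniv]

end General

/-! ### Connected sets in the triangular snake -/

section Snake

variable {n : ℕ}

lemma snakeGraph_three_adj {u w : Fin (n * (3 - 1) + 1)} :
    (snakeGraph 3 n).Adj u w ↔ u ≠ w ∧ ∃ i < n,
      2 * i ≤ (u : ℕ) ∧ (u : ℕ) ≤ 2 * i + 2 ∧ 2 * i ≤ (w : ℕ) ∧ (w : ℕ) ≤ 2 * i + 2 := by
  constructor
  · rintro ⟨i, a, b, h, hu, hw⟩
    refine ⟨fun huw => h.ne (Fin.ext (by rw [huw] at hu; omega)), i, i.2, ?_⟩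
    omega
  · rintro ⟨huw, i, hi, h⟩
    have hne : (u : ℕ) ≠ w := fun h => huw (Fin.ext h)
    refine ⟨⟨i, hi⟩, ⟨u - 2 * i, by omega⟩, ⟨w - 2 * i, by omega⟩, ?_, ?_, ?_⟩
    · rw [SimpleGraph.cycleGraph_three_eq_top, SimpleGraph.top_adj, ne_eq, Fin.mk.injEq]
      omega
    · simp only; omega
    · simp only; omega

/-- The path vertices of `S` are exactly `2 * a, 2 * (a + 1), …, 2 * b` (at least one), and every
other vertex of `S` is the apex of a triangle at one of them. -/
def IsSnakeSpan (S : Finset (Fin (n * (3 - 1) + 1))) (a b : ℕ) : Prop :=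
  a ≤ b ∧ b ≤ n ∧ (∀ x ∈ S, 2 * a ≤ (x : ℕ) + 1 ∧ (x : ℕ) ≤ 2 * b + 1) ∧
    ∀ x : Fin (n * (3 - 1) + 1), (x : ℕ) % 2 = 0 → 2 * a ≤ x → (x : ℕ) ≤ 2 * b → x ∈ S

lemma IsSnakeSpan.unique {S : Finset (Fin (n * (3 - 1) + 1))} {a b a' b' : ℕ}
    (h : IsSnakeSpan S a b) (h' : IsSnakeSpan S a' b') : a = a' ∧ b = b' := by
  obtain ⟨hab, hb, hS, hev⟩ := h
  obtain ⟨hab', hb', hS', hev'⟩ := h'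
  have h1 := hS' ⟨2 * a, by omega⟩ (hev _ (by simp) (by simp) (by simp; omega))
  have h2 := hS' ⟨2 * b, by omega⟩ (hev _ (by simp) (by simp; omega) (by simp))
  have h3 := hS ⟨2 * a', by omega⟩ (hev' _ (by simp) (by simp) (by simp; omega))
  have h4 := hS ⟨2 * b', by omega⟩ (hev' _ (by simp) (by simp; omega) (by simp))
  simp only at h1 h2 h3 h4
  omega

lemma isSnakeSpan_univ : IsSnakeSpan (univ : Finset (Fin (n * (3 - 1) + 1))) 0 n :=
  ⟨by omega, le_rfl, fun x _ => by omega, fun x _ _ _ => mem_univ x⟩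

lemma isSnakeSpan_singleton {i : ℕ} (hi : i ≤ n) :
    IsSnakeSpan {(⟨2 * i, by omega⟩ : Fin (n * (3 - 1) + 1))} i i := by
  refine ⟨le_rfl, hi, fun x hx => ?_, fun x _ h1 h2 => ?_⟩
  · rw [mem_singleton.1 hx]; simp
  · exact mem_singleton.2 (Fin.ext (by simp only; omega))

lemma IsSnakeSpan.insert_left {S : Finset (Fin (n * (3 - 1) + 1))} {a b : ℕ}
    (h : IsSnakeSpan S a b) {w : Fin (n * (3 - 1) + 1)} (hw : (w : ℕ) + 2 = 2 * a) :
    IsSnakeSpan (insert w S) (a - 1) b := by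
  obtain ⟨hab, hb, hS, hev⟩ := h
  refine ⟨by omega, hb, fun x hx => ?_, fun x h0 h1 h2 => ?_⟩
  · rcases mem_insert.1 hx with rfl | hx
    · omega
    · have := hS x hx; omega
  · by_cases hxw : x = w
    · exact hxw ▸ mem_insert_self _ _
    · have : (x : ℕ) ≠ w := fun h => hxw (Fin.ext h)
      exact mem_insert_of_mem (hev x h0 (by omega) h2)

lemma IsSnakeSpan.insert_right {S : Finset (Fin (n * (3 - 1) + 1))} {a b : ℕ}
    (h : IsSnakeSpan S a b) {w : Fin (n * (3 - 1) + 1)} (hw : (w : ℕ) = 2 * b + 2) :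
    IsSnakeSpan (insert w S) a (b + 1) := by
  obtain ⟨hab, hb, hS, hev⟩ := h
  refine ⟨by omega, by omega, fun x hx => ?_, fun x h0 h1 h2 => ?_⟩
  · rcases mem_insert.1 hx with rfl | hx
    · omega
    · have := hS x hx; omega
  · by_cases hxw : x = w
    · exact hxw ▸ mem_insert_self _ _
    · have : (x : ℕ) ≠ w := fun h => hxw (Fin.ext h)
      exact mem_insert_of_mem (hev x h0 h1 (by omega))

lemma IsSnakeSpan.insert_apex {S : Finset (Fin (n * (3 - 1) + 1))} {a b : ℕ}
    (h : IsSnakeSpan S a b) {w : Fin (n * (3 - 1) + 1)} (h1 : 2 * a ≤ (w : ℕ) + 1)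
    (h2 : (w : ℕ) ≤ 2 * b + 1) : IsSnakeSpan (insert w S) a b := by
  obtain ⟨hab, hb, hS, hev⟩ := h
  refine ⟨hab, hb, fun x hx => ?_, fun x h0 h1 h2 => mem_insert_of_mem (hev x h0 h1 h2)⟩
  rcases mem_insert.1 hx with rfl | hx
  · exact ⟨h1, h2⟩
  · exact hS x hx

noncomputable instance : DecidableRel (snakeGraph 3 n).Adj := Classical.decRel _

lemma IsSnakeSpan.mem_vertexBoundary {S : Finset (Fin (n * (3 - 1) + 1))} {a b : ℕ}
    (h : IsSnakeSpan S a b) {w : Fin (n * (3 - 1) + 1)} :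
    w ∈ vertexBoundary (snakeGraph 3 n) S ↔
      w ∉ S ∧ 2 * a ≤ (w : ℕ) + 2 ∧ (w : ℕ) ≤ 2 * b + 2 := by
  obtain ⟨hab, hb, hS, hev⟩ := h
  rw [_root_.mem_vertexBoundary]
  refine and_congr_right fun hw => ⟨?_, ?_⟩
  · rintro ⟨u, hu, huw⟩
    obtain ⟨-, i, hi, h⟩ := snakeGraph_three_adj.1 huw
    have := hS u hu
    omega
  · rintro ⟨h1, h2⟩
    have hodd : ¬ ((w : ℕ) % 2 = 0 ∧ 2 * a ≤ (w : ℕ) ∧ (w : ℕ) ≤ 2 * b) :=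
      fun h => hw (hev w h.1 h.2.1 h.2.2)
    have hwn := w.2
    by_cases hl : (w : ℕ) < 2 * a
    · have hu : (⟨2 * a, by omega⟩ : Fin (n * (3 - 1) + 1)) ∈ S :=
        hev _ (by simp) (by simp) (by simp; omega)
      refine ⟨_, hu, snakeGraph_three_adj.2 ⟨fun h => hw (h ▸ hu), a - 1, by omega, ?_⟩⟩
      simp only; omega
    by_cases hr : 2 * b < (w : ℕ)
    · have hu : (⟨2 * b, by omega⟩ : Fin (n * (3 - 1) + 1)) ∈ S :=
        hev _ (by simp) (by simp; omega) (by simp)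
      refine ⟨_, hu, snakeGraph_three_adj.2 ⟨fun h => hw (h ▸ hu), b, by omega, ?_⟩⟩
      simp only; omega
    · have hu : (⟨w - 1, by omega⟩ : Fin (n * (3 - 1) + 1)) ∈ S :=
        hev _ (by simp only; omega) (by simp only; omega) (by simp only; omega)
      refine ⟨_, hu, snakeGraph_three_adj.2 ⟨fun h => hw (h ▸ hu), w / 2, by omega, ?_⟩⟩
      simp only; omega

lemma IsSnakeSpan.exists_insert {S : Finset (Fin (n * (3 - 1) + 1))} {a b : ℕ}
    (h : IsSnakeSpan S a b) {w : Fin (n * (3 - 1) + 1)}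
    (hw : w ∈ vertexBoundary (snakeGraph 3 n) S) : ∃ a' b', IsSnakeSpan (insert w S) a' b' := by
  obtain ⟨-, h1, h2⟩ := h.mem_vertexBoundary.1 hw
  by_cases hl : (w : ℕ) + 2 = 2 * a
  · exact ⟨_, _, h.insert_left hl⟩
  by_cases hr : (w : ℕ) = 2 * b + 2
  · exact ⟨_, _, h.insert_right hr⟩
  · exact ⟨_, _, h.insert_apex (by omega) (by omega)⟩

lemma vertexBoundary_apex {i : ℕ} (hi : i < n) :
    vertexBoundary (snakeGraph 3 n) {(⟨2 * i + 1, by omega⟩ : Fin (n * (3 - 1) + 1))} =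
      {⟨2 * i, by omega⟩, ⟨2 * i + 2, by omega⟩} := by
  ext w
  simp only [mem_vertexBoundary, mem_singleton, exists_eq_left, mem_insert, snakeGraph_three_adj]
  simp only [Fin.ext_iff, ne_eq]
  constructor
  · rintro ⟨-, hne, j, hj, h⟩; omega
  · intro h; exact ⟨by omega, by omega, i, hi, by omega⟩

lemma isSnakeSpan_apex_left {i : ℕ} (hi : i < n) :
    IsSnakeSpan {(⟨2 * i, by omega⟩ : Fin (n * (3 - 1) + 1)), ⟨2 * i + 1, by omega⟩} i i := by
  rw [pair_comm]
  exact (isSnakeSpan_singleton hi.le).insert_apex (by simp only; omega) (by simp only; omega)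

lemma isSnakeSpan_apex_right {i : ℕ} (hi : i < n) :
    IsSnakeSpan {(⟨2 * i + 2, by omega⟩ : Fin (n * (3 - 1) + 1)), ⟨2 * i + 1, by omega⟩}
      (i + 1) (i + 1) := by
  rw [pair_comm]
  exact (isSnakeSpan_singleton hi).insert_apex (by simp only; omega) (by simp only; omega)

/-! ### The weight of a connected set -/

/-- The reciprocal `2 ^ k * k! / (2 * k)!` of the double factorial `(2 * k - 1)‼`. It is the
proportion of admissible orders among all orders of the vertices of `k` triangles that hang on a
labeled end vertex. -/
def snakeFactor (k : ℕ) : ℚ := 2 ^ k * k.factorial / (2 * k).factorial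

lemma snakeFactor_pred {k : ℕ} (hk : 1 ≤ k) :
    snakeFactor (k - 1) = (2 * k - 1) * snakeFactor k := by
  obtain ⟨j, rfl⟩ : ∃ j, k = j + 1 := ⟨k - 1, by omega⟩
  simp only [snakeFactor, Nat.add_sub_cancel, mul_add, mul_one, Nat.factorial_succ, pow_succ]
  have := Nat.factorial_ne_zero (2 * j)
  push_cast
  field_simp
  ring

open Classical in
/-- The weight of a set whose path vertices are `2 * a, …, 2 * b`: the factorial of the number of
missing vertices times the factors of the `a` triangles on the left and the `n - b` triangles on
the right. Sets without such a span get weight `0`. -/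
noncomputable def spanWeight (S : Finset (Fin (n * (3 - 1) + 1))) : ℚ :=
  if h : ∃ p : ℕ × ℕ, IsSnakeSpan S p.1 p.2 then
    (Sᶜ.card).factorial * (snakeFactor h.choose.1 * snakeFactor (n - h.choose.2))
  else 0

lemma IsSnakeSpan.spanWeight_eq {S : Finset (Fin (n * (3 - 1) + 1))} {a b : ℕ}
    (h : IsSnakeSpan S a b) :
    spanWeight S = (Sᶜ.card).factorial * (snakeFactor a * snakeFactor (n - b)) := by
  have hex : ∃ p : ℕ × ℕ, IsSnakeSpan S p.1 p.2 := ⟨(a, b), h⟩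
  rw [spanWeight, dif_pos hex, (hex.choose_spec.unique h).1, (hex.choose_spec.unique h).2]

lemma card_filter_val_lt {c : ℕ} (hc : c ≤ 2 * n + 1) :
    (univ.filter fun w : Fin (n * (3 - 1) + 1) => (w : ℕ) < c).card = c := by
  rw [Fin.card_filter_val_lt]; omega

lemma IsSnakeSpan.spanWeight_insert {S : Finset (Fin (n * (3 - 1) + 1))} {a b : ℕ}
    {w : Fin (n * (3 - 1) + 1)} (hw : w ∉ S) (h : IsSnakeSpan (insert w S) a b) :
    spanWeight (insert w S) =
      ((Sᶜ.card - 1).factorial : ℚ) * (snakeFactor a * snakeFactor (n - b)) := by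
  rw [h.spanWeight_eq, card_compl, card_compl, card_insert_of_notMem hw, Nat.sub_add_eq]

/-- Summed over the boundary vertices to the left of the span, the left factor gets multiplied by
the number of missing vertices on the left: the boundary is one vertex, or an apex and a path
vertex, according to whether the apex next to the span is already there. -/
lemma IsSnakeSpan.sum_left {S : Finset (Fin (n * (3 - 1) + 1))} {a b : ℕ}
    (h : IsSnakeSpan S a b) :
    ∑ w ∈ (vertexBoundary (snakeGraph 3 n) S).filter (fun w : Fin _ => (w : ℕ) < 2 * a),
        spanWeight (insert w S) =
      (Sᶜ.filter fun w : Fin _ => (w : ℕ) < 2 * a).card *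
        ((Sᶜ.card - 1).factorial * (snakeFactor a * snakeFactor (n - b))) := by
  have ⟨hab, hb, hS, _⟩ := h
  rcases Nat.eq_zero_or_pos a with rfl | ha
  · simp
  obtain ⟨u, hu⟩ : ∃ u : Fin (n * (3 - 1) + 1), (u : ℕ) = 2 * a - 2 := ⟨⟨_, by omega⟩, rfl⟩
  obtain ⟨t, ht⟩ : ∃ t : Fin (n * (3 - 1) + 1), (t : ℕ) = 2 * a - 1 := ⟨⟨_, by omega⟩, rfl⟩
  have huS : u ∉ S := fun hmem => by have := hS u hmem; omega
  have hlt := card_filter_val_lt (n := n) (c := 2 * a) (by omega)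
  have hwu := (h.insert_left (w := u) (by omega)).spanWeight_insert huS
  by_cases htS : t ∈ S
  · have h1 : (vertexBoundary (snakeGraph 3 n) S).filter
        (fun w : Fin _ => (w : ℕ) < 2 * a) = {u} := by
      ext w
      simp only [mem_filter, h.mem_vertexBoundary, mem_singleton]
      constructor
      · rintro ⟨⟨hw, h2⟩, h3⟩
        have : (w : ℕ) ≠ t := fun heq => hw (Fin.ext heq ▸ htS)
        exact Fin.ext (by omega)
      · rintro rfl; exact ⟨⟨huS, by omega⟩, by omega⟩
    have h2 : Sᶜ.filter (fun w : Fin _ => (w : ℕ) < 2 * a) =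
        (univ.filter fun w : Fin (n * (3 - 1) + 1) => (w : ℕ) < 2 * a).erase t := by
      ext w
      simp only [mem_filter, mem_compl, mem_erase, mem_univ, true_and]
      refine and_congr_left fun hw => ⟨fun hwS heq => hwS (heq ▸ htS), fun hwt hwS => hwt ?_⟩
      have := hS w hwS
      exact Fin.ext (by omega)
    rw [h1, sum_singleton, hwu, snakeFactor_pred ha, h2, card_erase_of_mem (by simp; omega), hlt,
      Nat.cast_sub (by omega)]
    push_cast; ring
  · have h1 : (vertexBoundary (snakeGraph 3 n) S).filter
        (fun w : Fin _ => (w : ℕ) < 2 * a) = {u, t} := by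
      ext w
      simp only [mem_filter, h.mem_vertexBoundary, mem_insert, mem_singleton]
      constructor
      · rintro ⟨⟨hw, h2⟩, h3⟩
        rw [Fin.ext_iff, Fin.ext_iff]; omega
      · rintro (rfl | rfl)
        · exact ⟨⟨huS, by omega⟩, by omega⟩
        · exact ⟨⟨htS, by omega⟩, by omega⟩
    have h2 : Sᶜ.filter (fun w : Fin _ => (w : ℕ) < 2 * a) =
        univ.filter fun w : Fin (n * (3 - 1) + 1) => (w : ℕ) < 2 * a := by
      ext w
      simp only [mem_filter, mem_compl, mem_univ, true_and]
      refine and_iff_right_of_imp fun hw hwS => htS ?_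
      have := hS w hwS
      rwa [show t = w from Fin.ext (by omega)]
    rw [h1, sum_pair (fun heq => by rw [heq] at hu; omega), hwu,
      (h.insert_apex (w := t) (by omega) (by omega)).spanWeight_insert htS,
      snakeFactor_pred ha, h2, hlt]
    push_cast; ring

/-- The counterpart of `IsSnakeSpan.sum_left` on the right of the span. -/
lemma IsSnakeSpan.sum_right {S : Finset (Fin (n * (3 - 1) + 1))} {a b : ℕ}
    (h : IsSnakeSpan S a b) :
    ∑ w ∈ (vertexBoundary (snakeGraph 3 n) S).filter (fun w : Fin _ => 2 * b < (w : ℕ)),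
        spanWeight (insert w S) =
      (Sᶜ.filter fun w : Fin _ => 2 * b < (w : ℕ)).card *
        ((Sᶜ.card - 1).factorial * (snakeFactor a * snakeFactor (n - b))) := by
  have ⟨hab, hb, hS, _⟩ := h
  have hlt : (univ.filter fun w : Fin (n * (3 - 1) + 1) => 2 * b < (w : ℕ)).card =
      2 * (n - b) := by
    have h1 := card_filter_add_card_filter_not (s := (univ : Finset (Fin (n * (3 - 1) + 1))))
      (fun w => (w : ℕ) < 2 * b + 1)
    have h2 := card_filter_val_lt (n := n) (c := 2 * b + 1) (by omega)
    simp only [not_lt, Nat.succ_le_iff, card_univ, Fintype.card_fin] at h1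
    omega
  rcases hb.eq_or_lt with rfl | hbn
  · have hno : ∀ w : Fin (b * (3 - 1) + 1), ¬ 2 * b < (w : ℕ) := fun w => by omega
    simp [hno]
  obtain ⟨u, hu⟩ : ∃ u : Fin (n * (3 - 1) + 1), (u : ℕ) = 2 * b + 2 := ⟨⟨_, by omega⟩, rfl⟩
  obtain ⟨t, ht⟩ : ∃ t : Fin (n * (3 - 1) + 1), (t : ℕ) = 2 * b + 1 := ⟨⟨_, by omega⟩, rfl⟩
  have huS : u ∉ S := fun hmem => by have := hS u hmem; omega
  have hwu := (h.insert_right hu).spanWeight_insert huS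
  have hpred := snakeFactor_pred (k := n - b) (by omega)
  rw [Nat.sub_sub] at hpred
  by_cases htS : t ∈ S
  · have h1 : (vertexBoundary (snakeGraph 3 n) S).filter
        (fun w : Fin _ => 2 * b < (w : ℕ)) = {u} := by
      ext w
      simp only [mem_filter, h.mem_vertexBoundary, mem_singleton]
      constructor
      · rintro ⟨⟨hw, h2⟩, h3⟩
        have : (w : ℕ) ≠ t := fun heq => hw (Fin.ext heq ▸ htS)
        exact Fin.ext (by omega)
      · rintro rfl; exact ⟨⟨huS, by omega⟩, by omega⟩
    have h2 : Sᶜ.filter (fun w : Fin _ => 2 * b < (w : ℕ)) =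
        (univ.filter fun w : Fin (n * (3 - 1) + 1) => 2 * b < (w : ℕ)).erase t := by
      ext w
      simp only [mem_filter, mem_compl, mem_erase, mem_univ, true_and]
      refine and_congr_left fun hw => ⟨fun hwS heq => hwS (heq ▸ htS), fun hwt hwS => hwt ?_⟩
      have := hS w hwS
      exact Fin.ext (by omega)
    rw [h1, sum_singleton, hwu, hpred, h2, card_erase_of_mem (by simp; omega), hlt,
      Nat.cast_sub (by omega : 1 ≤ 2 * (n - b))]
    push_cast; ring
  · have h1 : (vertexBoundary (snakeGraph 3 n) S).filter
        (fun w : Fin _ => 2 * b < (w : ℕ)) =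
        {u, t} := by
      ext w
      simp only [mem_filter, h.mem_vertexBoundary, mem_insert, mem_singleton]
      constructor
      · rintro ⟨⟨hw, h2⟩, h3⟩
        rw [Fin.ext_iff, Fin.ext_iff]; omega
      · rintro (rfl | rfl)
        · exact ⟨⟨huS, by omega⟩, by omega⟩
        · exact ⟨⟨htS, by omega⟩, by omega⟩
    have h2 : Sᶜ.filter (fun w : Fin _ => 2 * b < (w : ℕ)) =
        univ.filter fun w : Fin (n * (3 - 1) + 1) => 2 * b < (w : ℕ) := by
      ext w
      simp only [mem_filter, mem_compl, mem_univ, true_and]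
      refine and_iff_right_of_imp fun hw hwS => htS ?_
      have := hS w hwS
      rwa [show t = w from Fin.ext (by omega)]
    rw [h1, sum_pair (fun heq => by rw [heq] at hu; omega), hwu,
      (h.insert_apex (w := t) (by omega) (by omega)).spanWeight_insert htS, hpred, h2, hlt]
    push_cast; ring

/-- Summed over the missing apexes inside the span: all of them are in the boundary, and adding
one changes neither factor. -/
lemma IsSnakeSpan.sum_inner {S : Finset (Fin (n * (3 - 1) + 1))} {a b : ℕ}
    (h : IsSnakeSpan S a b) :
    ∑ w ∈ (vertexBoundary (snakeGraph 3 n) S).filter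
        (fun w : Fin _ => 2 * a ≤ (w : ℕ) ∧ (w : ℕ) ≤ 2 * b),
        spanWeight (insert w S) =
      (Sᶜ.filter fun w : Fin _ => 2 * a ≤ (w : ℕ) ∧ (w : ℕ) ≤ 2 * b).card *
        ((Sᶜ.card - 1).factorial * (snakeFactor a * snakeFactor (n - b))) := by
  have h1 : (vertexBoundary (snakeGraph 3 n) S).filter
      (fun w : Fin _ => 2 * a ≤ (w : ℕ) ∧ (w : ℕ) ≤ 2 * b) =
      Sᶜ.filter fun w : Fin _ => 2 * a ≤ (w : ℕ) ∧ (w : ℕ) ≤ 2 * b := by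
    ext w
    simp only [mem_filter, h.mem_vertexBoundary, mem_compl]
    constructor
    · rintro ⟨⟨hw, -⟩, h3⟩; exact ⟨hw, h3⟩
    · rintro ⟨hw, h3⟩; exact ⟨⟨hw, by omega⟩, h3⟩
  rw [h1, ← nsmul_eq_mul]
  refine sum_eq_card_nsmul fun w hw => ?_
  obtain ⟨hw, h2, h3⟩ := mem_filter.1 hw
  exact (h.insert_apex (by omega) (by omega)).spanWeight_insert (mem_compl.1 hw)

lemma sum_eq_left_add_right_add_inner {a b : ℕ} (hab : a ≤ b)
    (s : Finset (Fin (n * (3 - 1) + 1))) (f : Fin (n * (3 - 1) + 1) → ℚ) :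
    ∑ w ∈ s, f w = ∑ w ∈ s.filter (fun w : Fin _ => (w : ℕ) < 2 * a), f w +
      ∑ w ∈ s.filter (fun w : Fin _ => 2 * b < (w : ℕ)), f w +
      ∑ w ∈ s.filter (fun w : Fin _ => 2 * a ≤ (w : ℕ) ∧ (w : ℕ) ≤ 2 * b), f w := by
  simp only [sum_filter, ← sum_add_distrib]
  refine sum_congr rfl fun w _ => ?_
  by_cases h1 : (w : ℕ) < 2 * a
  · simp [h1, show ¬ 2 * b < (w : ℕ) by omega, show ¬ 2 * a ≤ (w : ℕ) by omega]
  by_cases h2 : 2 * b < (w : ℕ)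
  · simp [h1, h2, show ¬ (w : ℕ) ≤ 2 * b by omega]
  · simp [h1, h2, not_lt.1 h1, not_lt.1 h2]

lemma IsSnakeSpan.spanWeight_eq_sum {S : Finset (Fin (n * (3 - 1) + 1))} {a b : ℕ}
    (h : IsSnakeSpan S a b) (hS : S ≠ univ) :
    spanWeight S = ∑ w ∈ vertexBoundary (snakeGraph 3 n) S, spanWeight (insert w S) := by
  have hpos : 0 < Sᶜ.card := card_pos.2 (by rwa [nonempty_iff_ne_empty, ne_eq, compl_eq_empty_iff])
  have hcard := sum_eq_left_add_right_add_inner h.1 Sᶜ fun _ => 1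
  simp only [sum_const, nsmul_eq_mul, mul_one] at hcard
  rw [sum_eq_left_add_right_add_inner h.1, h.sum_left, h.sum_right, h.sum_inner, ← add_mul,
    ← add_mul, ← hcard, h.spanWeight_eq, ← mul_assoc, ← Nat.mul_factorial_pred hpos.ne']
  push_cast; ring

open Classical in
/-- The weight of a set that the process can label: the weight of its span, or, for a single apex,
the total weight of its one-vertex extensions. -/
noncomputable def snakeWeight (S : Finset (Fin (n * (3 - 1) + 1))) : ℚ :=
  if ∃ a b, IsSnakeSpan S a b then spanWeight S
  else ∑ w ∈ vertexBoundary (snakeGraph 3 n) S, spanWeight (insert w S)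

lemma IsSnakeSpan.snakeWeight_eq {S : Finset (Fin (n * (3 - 1) + 1))} {a b : ℕ}
    (h : IsSnakeSpan S a b) :
    snakeWeight S = ((Sᶜ.card).factorial : ℚ) * (snakeFactor a * snakeFactor (n - b)) := by
  rw [snakeWeight, if_pos ⟨a, b, h⟩, h.spanWeight_eq]

lemma not_isSnakeSpan_apex {i : ℕ} (hi : i < n) (a b : ℕ) :
    ¬ IsSnakeSpan {(⟨2 * i + 1, by omega⟩ : Fin (n * (3 - 1) + 1))} a b := by
  rintro ⟨hab, hb, -, hev⟩
  have := hev ⟨2 * a, by omega⟩ (by simp) (by simp) (by simp; omega)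
  rw [mem_singleton, Fin.mk.injEq] at this
  omega

lemma snakeWeight_path {i : ℕ} (hi : i ≤ n) :
    snakeWeight {(⟨2 * i, by omega⟩ : Fin (n * (3 - 1) + 1))} =
      ((2 * n).factorial : ℚ) * (snakeFactor i * snakeFactor (n - i)) := by
  rw [(isSnakeSpan_singleton hi).snakeWeight_eq, card_compl, card_singleton, Fintype.card_fin,
    show n * (3 - 1) + 1 - 1 = 2 * n by omega]

lemma snakeWeight_apex {i : ℕ} (hi : i < n) :
    snakeWeight {(⟨2 * i + 1, by omega⟩ : Fin (n * (3 - 1) + 1))} =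
      ((2 * n - 1).factorial : ℚ) * (snakeFactor i * snakeFactor (n - i)) +
      ((2 * n - 1).factorial : ℚ) * (snakeFactor (i + 1) * snakeFactor (n - (i + 1))) := by
  rw [snakeWeight, if_neg (by rintro ⟨a, b, h⟩; exact not_isSnakeSpan_apex hi a b h),
    vertexBoundary_apex hi, sum_pair (by simp),
    (isSnakeSpan_apex_left hi).spanWeight_insert (by simp),
    (isSnakeSpan_apex_right hi).spanWeight_insert (by simp), card_compl, card_singleton,
    Fintype.card_fin, show n * (3 - 1) + 1 - 1 - 1 = 2 * n - 1 by omega]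

lemma numRandomWalkLabelings_snakeGraph_eq_sum (hn : 1 ≤ n) :
    (numRandomWalkLabelings (snakeGraph 3 n) : ℚ) =
      ∑ v : Fin (n * (3 - 1) + 1), snakeWeight {v} := by
  refine numRandomWalkLabelings_eq_sum (G := snakeGraph 3 n)
    (fun S => (∃ a b, IsSnakeSpan S a b) ∨ ∃ i, ∃ hi : i < n, S = {⟨2 * i + 1, by omega⟩})
    snakeWeight (fun v => ?_) (fun S hS w hw => .inl ?_) (fun S hS hne => ?_) ?_
  · rcases Nat.even_or_odd' (v : ℕ) with ⟨i, hi | hi⟩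
    · refine .inl ⟨i, i, ?_⟩
      rw [show v = ⟨2 * i, by omega⟩ from Fin.ext hi]
      exact isSnakeSpan_singleton (by omega)
    · exact .inr ⟨i, by omega, by rw [singleton_inj]; exact Fin.ext hi⟩
  · rcases hS with ⟨a, b, h⟩ | ⟨i, hi, rfl⟩
    · exact h.exists_insert hw
    · rw [vertexBoundary_apex hi, mem_insert, mem_singleton] at hw
      rcases hw with rfl | rfl
      · exact ⟨_, _, isSnakeSpan_apex_left hi⟩
      · exact ⟨_, _, isSnakeSpan_apex_right hi⟩
  · rcases hS with ⟨a, b, h⟩ | ⟨i, hi, rfl⟩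
    · rw [snakeWeight, if_pos ⟨a, b, h⟩, h.spanWeight_eq_sum hne]
      exact sum_congr rfl fun w hw => (if_pos (h.exists_insert hw)).symm
    · rw [snakeWeight_apex hi, vertexBoundary_apex hi, sum_pair (by simp),
        (isSnakeSpan_apex_left hi).snakeWeight_eq, (isSnakeSpan_apex_right hi).snakeWeight_eq,
        card_compl, card_compl, card_pair (by simp), card_pair (by simp), Fintype.card_fin,
        show n * (3 - 1) + 1 - 2 = 2 * n - 1 by omega]
  · rw [isSnakeSpan_univ.snakeWeight_eq]
    simp [snakeFactor]

end Snake

/-! ### Evaluation of the sum -/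

lemma sum_range_two_mul_add_one (f : ℕ → ℚ) (n : ℕ) :
    ∑ x ∈ range (2 * n + 1), f x =
      ∑ i ∈ range (n + 1), f (2 * i) + ∑ i ∈ range n, f (2 * i + 1) := by
  induction n with
  | zero => simp
  | succ n ih =>
    rw [show 2 * (n + 1) + 1 = 2 * n + 1 + 1 + 1 by ring, sum_range_succ, sum_range_succ, ih,
      sum_range_succ _ (n + 1), sum_range_succ (fun i => f (2 * i + 1)) n,
      show 2 * (n + 1) = 2 * n + 1 + 1 by ring]
    ring

lemma factorial_mul_snakeFactor_mul {n i : ℕ} (hi : i ≤ n) :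
    ((2 * n).factorial : ℚ) * (snakeFactor i * snakeFactor (n - i)) =
      2 ^ n * n.factorial * ((2 * n).choose (2 * i) / n.choose i) := by
  rw [Nat.cast_choose ℚ hi, Nat.cast_choose ℚ (by omega : 2 * i ≤ 2 * n), snakeFactor, snakeFactor,
    ← Nat.mul_sub]
  have h1 : (2 : ℚ) ^ n = 2 ^ i * 2 ^ (n - i) := by rw [← pow_add]; congr 1; omega
  have := Nat.factorial_ne_zero n
  rw [h1]
  field_simp

lemma factorial_pred_mul_snakeFactor_mul {n i : ℕ} (hi : i < n) :
    ((2 * n - 1).factorial : ℚ) * (snakeFactor i * snakeFactor (n - i)) =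
      2 ^ (n - 1) * (n - 1).factorial * ((2 * n - 1).choose (2 * i) / (n - 1).choose i) := by
  rw [Nat.cast_choose ℚ (by omega : i ≤ n - 1),
    Nat.cast_choose ℚ (by omega : 2 * i ≤ 2 * n - 1), snakeFactor, snakeFactor]
  obtain ⟨j, rfl⟩ : ∃ j, n = i + j + 1 := ⟨n - i - 1, by omega⟩
  rw [show i + j + 1 - i = j + 1 by omega, show i + j + 1 - 1 = i + j by omega,
    show i + j - i = j by omega, show 2 * (i + j + 1) - 1 - 2 * i = 2 * j + 1 by omega,
    show 2 * (j + 1) = 2 * j + 1 + 1 by ring, Nat.factorial_succ (2 * j + 1),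
    Nat.factorial_succ j]
  have := Nat.factorial_ne_zero (i + j)
  have := Nat.factorial_ne_zero (2 * j + 1)
  push_cast
  field_simp
  ring

theorem mainTheorem12 (n : ℕ) (hn : 1 ≤ n) :
    (numRandomWalkLabelings (snakeGraph 3 n) : ℚ) =
      2 ^ n * (Nat.factorial (n - 1) : ℚ) *
        (∑ k ∈ Finset.range n,
            (Nat.choose (2 * n - 1) (2 * k) : ℚ) / (Nat.choose (n - 1) k : ℚ) +
          (n : ℚ) * ∑ k ∈ Finset.range (n + 1),
            (Nat.choose (2 * n) (2 * k) : ℚ) / (Nat.choose n k : ℚ)) := by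
  -- The weights of the singletons, as a function on `ℕ` that can be split by parity.
  let f : ℕ → ℚ := fun x =>
    if hx : x < n * (3 - 1) + 1 then snakeWeight {(⟨x, hx⟩ : Fin (n * (3 - 1) + 1))} else 0
  have hf : ∑ v : Fin (n * (3 - 1) + 1), snakeWeight {v} = ∑ x ∈ range (2 * n + 1), f x := by
    rw [show 2 * n + 1 = n * (3 - 1) + 1 by omega, ← Fin.sum_univ_eq_sum_range]
    exact sum_congr rfl fun v _ => by simp only [f, dif_pos v.2]
  have heven : ∑ i ∈ range (n + 1), f (2 * i) = ∑ i ∈ range (n + 1),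
      2 ^ n * n.factorial * ((2 * n).choose (2 * i) / n.choose i : ℚ) := by
    refine sum_congr rfl fun i hi => ?_
    have hi' : i ≤ n := by simpa [Nat.lt_succ_iff] using hi
    simp only [f]
    rw [dif_pos (by omega), snakeWeight_path hi', factorial_mul_snakeFactor_mul hi']
  -- The extensions of an apex to the right are the mirror images of those to the left.
  have hodd : ∑ i ∈ range n, f (2 * i + 1) = 2 * ∑ i ∈ range n,
      2 ^ (n - 1) * (n - 1).factorial * ((2 * n - 1).choose (2 * i) / (n - 1).choose i : ℚ) := by
    have hleft := sum_congr rfl fun i hi =>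
      factorial_pred_mul_snakeFactor_mul (n := n) (i := i) (mem_range.1 hi)
    rw [← hleft, two_mul]
    conv_rhs => enter [2]; rw [← sum_range_reflect]
    rw [← sum_add_distrib]
    refine sum_congr rfl fun i hi => ?_
    have hi' : i < n := mem_range.1 hi
    simp only [f]
    rw [dif_pos (by omega), snakeWeight_apex hi', show n - 1 - i = n - (i + 1) by omega,
      show n - (n - (i + 1)) = i + 1 by omega, mul_comm (snakeFactor (n - (i + 1)))]
  have hpow : (2 : ℚ) ^ n = 2 * 2 ^ (n - 1) := by rw [← pow_succ']; congr 1; omega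
  rw [numRandomWalkLabelings_snakeGraph_eq_sum hn, hf, sum_range_two_mul_add_one, heven, hodd,
    ← mul_sum, ← mul_sum, ← Nat.mul_factorial_pred (by omega : n ≠ 0), hpow]
  push_cast
  ring
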